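/- Let $\alpha_1,\alpha_2,\beta_1,\beta_2>0$, $\nu\in(0,1)$ and $\mu\ge 0$. Let $\{X(t):t\ge0\}$ be a continuous-time Markov chain on $\mathbb Z$ with right-continuous paths and whose transition probabilities have the generator $G=(g_{k,n})$ given by $$g_{k,k+1}=\begin{cases}\alpha_1&k\text{ even}\\ \beta_1&k\text{ odd},\end{cases}\qquad g_{k,k-1}=\begin{cases}\alpha_2&k\text{ even}\\ \beta_2&k\text{ odd},\end{cases}\qquad g_{k,k}=-(g_{k,k+1}+g_{k,k-1}),$$ and $g_{k,n}=0$ otherwise. Let $\{\tilde S^{\nu,\mu}(t):t\ge0\}$ be a (possibly tempered) stable subordinator independent of $\{X(t):t\ge 0\}$, i.e. a subordinator (a nondecreasing Lévy process with $\tilde S^{\nu,\mu}(0)=0$) whose law at time $t$ has density $x\mapsto e^{-\mu x+\mu^\nu t}$ with respect to the law of $S^\nu(t)$, where $S^\nu(t)\ge 0$ is stable, with $\mathbb E[e^{-\theta S^\nu(t)}]=e^{-t\theta^\nu}$ for all $\theta\ge0$. Put $\tilde X^{\nu,\mu}(t):=X(\tilde S^{\nu,\mu}(t))$ and, for $k\in\mathbb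 Z$ with $P(\tilde X^{\nu,\mu}(0)=k)>0$, let $$\tilde F_k^{\nu,\mu}(z,t):=\mathbb E\big[z^{\tilde X^{\nu,\mu}(t)}\,\big|\,\tilde X^{\nu,\mu}(0)=k\big]=\sum_{n\in\mathbb Z}z^n\,P\big(\tilde X^{\nu,\mu}(t)=n\,\big|\,\tilde X^{\nu,\mu}(0)=k\big)\in[0,\infty].$$ For $z>0$ let $$h(z):=\tfrac12\sqrt{(\alpha_1+\alpha_2-(\beta_1+\beta_2))^2z^2+4(\beta_1z^2+\beta_2)(\alpha_1z^2+\alpha_2)},\qquad \hat h_\pm(z):=-\frac{\alpha_1+\alpha_2+\beta_1+\beta_2}{2}\pm\frac{h(z)}{z},$$ $$c_k(z):=\begin{cases}\frac{(\beta_1+\beta_2-(\alpha_1+\alpha_2))z}{2}+\alpha_1z^2+\alpha_2&k\text{ even}\\[2pt] \frac{(\alpha_1+\alpha_2-(\beta_1+\beta_2))z}{2}+\beta_1z^2+\beta_2&k\text{ odd}.\end{cases}$$ Then the two expressions for $\tilde F_k^{\nu,\mu}(z,t)$ above agree, and for all $z>0$ the following holds. If $\hat h_+(z)\le\mu$, then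 for all $t\ge0$ $$\tilde F_k^{\nu,\mu}(z,t)=z^k\left(\frac{e^{-t((\mu-\hat h_+(z))^\nu-\mu^\nu)}+e^{-t((\mu-\hat h_-(z))^\nu-\mu^\nu)}}{2}+\frac{c_k(z)}{h(z)}\cdot\frac{e^{-t((\mu-\hat h_+(z))^\nu-\mu^\nu)}-e^{-t((\mu-\hat h_-(z))^\nu-\mu^\nu)}}{2}\right).$$ If $\hat h_+(z)>\mu$, then $\tilde F_k^{\nu,\mu}(z,t)=\infty$ for all $t>0$. -/

import Mathlib

open MeasureTheory ProbabilityTheory Filter Topology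
open scoped NNReal ENNReal

namespace AlternatingChain

noncomputable section

/-! ### Continuous-time Markov chains on `ℤ` -/

/-- The generator of the chain with alternating rates: from an even state the chain jumps up at
rate `α₁` and down at rate `α₂`, from an odd state up at rate `β₁` and down at rate `β₂`. -/
def generator (α₁ α₂ β₁ β₂ : ℝ) (k n : ℤ) : ℝ :=
  if n = k then (if Even k then -(α₁ + α₂) else -(β₁ + β₂))
  else if n = k + 1 then (if Even k then α₁ else β₁)
  else if n = k - 1 then (if Even k then α₂ else β₂)
  else 0

/-- `p t k n` is a (stochastic) transition function on `ℤ`: the matrices `p t` are stochastic,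
`p 0` is the identity and the Chapman-Kolmogorov equations hold. -/
structure IsTransitionFunction (p : ℝ≥0 → ℤ → ℤ → ℝ) : Prop where
  nonneg : ∀ t k n, 0 ≤ p t k n
  hasSum_one : ∀ t k, HasSum (p t k) 1
  zero : ∀ k n, p 0 k n = if k = n then 1 else 0
  chapmanKolmogorov : ∀ s t k n, HasSum (fun m => p s k m * p t m n) (p (s + t) k n)

/-- The transition function `p` has generator `G`: `(p t k n - p 0 k n) / t → G k n` as `t → 0+`. -/
def HasGenerator (p : ℝ≥0 → ℤ → ℤ → ℝ) (G : ℤ → ℤ → ℝ) : Prop :=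
  ∀ k n, Tendsto (fun t : ℝ≥0 => (p t k n - p 0 k n) / (t : ℝ)) (𝓝[>] 0) (𝓝 (G k n))

/-- `X` is a time-homogeneous continuous-time Markov chain on `ℤ` with generator `G`, with almost
surely right-continuous paths (and an arbitrary initial law) under `P`. In `markov`, the event
`X (t 0) = i 0, …, X (t m) = i m` is the past, `t m` the present and `t m + s` the future. -/
structure IsMarkovChain {Ω : Type*} [MeasurableSpace Ω] (P : Measure Ω)
    (X : ℝ≥0 → Ω → ℤ) (G : ℤ → ℤ → ℝ) : Prop where
  measurable : ∀ t, Measurable (X t)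
  rightContinuous : ∀ᵐ ω ∂P, ∀ t, ContinuousWithinAt (fun s => X s ω) (Set.Ici t) t
  markov : ∃ p : ℝ≥0 → ℤ → ℤ → ℝ, IsTransitionFunction p ∧ HasGenerator p G ∧
    ∀ (m : ℕ) (t : Fin (m + 1) → ℝ≥0) (i : Fin (m + 1) → ℤ) (s : ℝ≥0) (j : ℤ), Monotone t →
      P {ω | (∀ l, X (t l) ω = i l) ∧ X (t (Fin.last m) + s) ω = j} =
        P {ω | ∀ l, X (t l) ω = i l} * ENNReal.ofReal (p s (i (Fin.last m)) j)

/-! ### Stable and tempered stable subordinators -/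

/-- `S` is a subordinator under `P`: a Lévy process with nondecreasing paths, started at `0`.
The values are taken in `ℝ≥0`; the increments are the differences as real numbers. -/
structure IsSubordinator {Ω : Type*} [MeasurableSpace Ω] (P : Measure Ω)
    (S : ℝ≥0 → Ω → ℝ≥0) : Prop where
  measurable : ∀ t, Measurable (S t)
  zero : ∀ᵐ ω ∂P, S 0 ω = 0
  monotone : ∀ᵐ ω ∂P, Monotone (fun t => S t ω)
  rightContinuous : ∀ᵐ ω ∂P, ∀ t, ContinuousWithinAt (fun s => S s ω) (Set.Ici t) t
  indepIncrements : HasIndepIncrements (fun t ω => (S t ω : ℝ)) P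
  stationaryIncrements : ∀ s t,
    IdentDistrib (fun ω => (S (s + t) ω : ℝ) - (S s ω : ℝ)) (fun ω => (S t ω : ℝ)) P P

/-- `σ` is the law on `[0, ∞)` of the `ν`-stable subordinator at time `t`: the probability
measure with Laplace transform `θ ↦ exp (-t θ ^ ν)`, `θ ≥ 0`. -/
def IsStableLaw (ν : ℝ) (t : ℝ≥0) (σ : Measure ℝ≥0) : Prop :=
  IsProbabilityMeasure σ ∧
    ∀ θ : ℝ, 0 ≤ θ → ∫ x, Real.exp (-(θ * (x : ℝ))) ∂σ = Real.exp (-((t : ℝ) * θ ^ ν))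

/-- `S` is the (possibly tempered) stable subordinator with stability index `ν` and tempering
parameter `μ`: the subordinator whose law at time `t` has density `x ↦ exp (-μ x + μ ^ ν t)` with
respect to the law of the `ν`-stable subordinator at time `t`. For `μ = 0` it is the stable
subordinator itself. -/
structure IsTemperedStableSubordinator {Ω : Type*} [MeasurableSpace Ω] (P : Measure Ω)
    (ν μ : ℝ) (S : ℝ≥0 → Ω → ℝ≥0) : Prop extends IsSubordinator P S where
  law : ∀ t, ∃ σ : Measure ℝ≥0, IsStableLaw ν t σ ∧
    P.map (S t) = σ.withDensity
      (fun x => ENNReal.ofReal (Real.exp (-(μ * (x : ℝ)) + μ ^ ν * (t : ℝ))))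

/-! ### The time-changed process and its probability generating functions -/

/-- The time-changed process `t ↦ X (S t)`. -/
def timeChange {Ω : Type*} (X : ℝ≥0 → Ω → ℤ) (S : ℝ≥0 → Ω → ℝ≥0) (t : ℝ≥0) (ω : Ω) : ℤ :=
  X (S t ω) ω

/-- The state probability `P (Y t = n | Y 0 = k)`. -/
def stateProb {Ω : Type*} [MeasurableSpace Ω] (P : Measure Ω) (Y : ℝ≥0 → Ω → ℤ)
    (k n : ℤ) (t : ℝ≥0) : ℝ≥0∞ :=
  (cond P {ω | Y 0 ω = k}) {ω | Y t ω = n}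

/-- The probability generating function `E [z ^ (Y t) | Y 0 = k]` at `z > 0`, as an element
of `[0, ∞]`. -/
def pgf {Ω : Type*} [MeasurableSpace Ω] (P : Measure Ω) (Y : ℝ≥0 → Ω → ℤ)
    (k : ℤ) (z : ℝ) (t : ℝ≥0) : ℝ≥0∞ :=
  ∫⁻ ω, ENNReal.ofReal (z ^ Y t ω) ∂(cond P {ω | Y 0 ω = k})

/-! ### The explicit functions -/

/-- `h z = ½ √((α₁ + α₂ - (β₁ + β₂))² z² + 4 (β₁ z² + β₂) (α₁ z² + α₂))`. -/
def h (α₁ α₂ β₁ β₂ z : ℝ) : ℝ :=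
  1 / 2 * √((α₁ + α₂ - (β₁ + β₂)) ^ 2 * z ^ 2 + 4 * (β₁ * z ^ 2 + β₂) * (α₁ * z ^ 2 + α₂))

/-- `ĥ₊ z`. -/
def hPlus (α₁ α₂ β₁ β₂ z : ℝ) : ℝ :=
  -((α₁ + α₂ + β₁ + β₂) / 2) + h α₁ α₂ β₁ β₂ z / z

/-- `ĥ₋ z`. -/
def hMinus (α₁ α₂ β₁ β₂ z : ℝ) : ℝ :=
  -((α₁ + α₂ + β₁ + β₂) / 2) - h α₁ α₂ β₁ β₂ z / z

/-- The coefficient `c_k z`. -/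
def c (α₁ α₂ β₁ β₂ : ℝ) (k : ℤ) (z : ℝ) : ℝ :=
  if Even k then (β₁ + β₂ - (α₁ + α₂)) * z / 2 + α₁ * z ^ 2 + α₂
  else (α₁ + α₂ - (β₁ + β₂)) * z / 2 + β₁ * z ^ 2 + β₂

end

end AlternatingChain

/-! By independence, the state probabilities of the time-changed chain are `∫ p x k n` integrated
against the law of `S t` (`stateProb_timeChange`), so its generating function is the integral of the
chain's own generating function against that law (`pgf_timeChange`).

The rates are bounded, so the generator determines the transition function: `p t = exp (-q t) ∑ t ^
j / j! (q I + G) ^ j` (`IsUniformizable.hasSum_uniformization`). The entries of `q I + G` are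
nonnegative, hence all sums may be interchanged in `[0, ∞]`. The functions `z ^ k` times a function
of the parity of `k` form a plane invariant under `G`. On it `G` has the eigenvalues `hPlus` and
`hMinus`, with eigenfunctions `z ^ k (± h + c_k)` (`jump_eigenfunction`). Splitting `z ^ k` along
them gives `chainPgf`, a combination of `exp (x hPlus)` and `exp (x hMinus)`.

Against the tempered density each exponential `exp (x a)` becomes the stable Laplace transform at `μ
- a`, which yields the formula if `hPlus ≤ μ`. If `hPlus > μ`, the weight `h + c_k` of the larger
exponential is positive, so the integrand dominates a positive multiple of `x`, and a stable law has
infinite mean (`IsStableLaw.lintegral_eq_top`). -/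

namespace AlternatingChain

/-! ### Transition functions with bounded generator -/

namespace IsTransitionFunction

variable {p : ℝ≥0 → ℤ → ℤ → ℝ} (hp : IsTransitionFunction p)
include hp

lemma sum_le_one (t : ℝ≥0) (k : ℤ) (s : Finset ℤ) : ∑ m ∈ s, p t k m ≤ 1 :=
  sum_le_hasSum s (fun m _ => hp.nonneg t k m) (hp.hasSum_one t k)

lemma le_one (t : ℝ≥0) (k n : ℤ) : p t k n ≤ 1 := by
  simpa using hp.sum_le_one t k {n}

lemma sum_mul_le (h t : ℝ≥0) (k n : ℤ) (s : Finset ℤ) :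
    ∑ m ∈ s, p h k m * p t m n ≤ p (h + t) k n :=
  sum_le_hasSum s (fun m _ => mul_nonneg (hp.nonneg h k m) (hp.nonneg t m n))
    (hp.chapmanKolmogorov h t k n)

lemma le_sum_mul_add (h t : ℝ≥0) (k n : ℤ) (s : Finset ℤ) :
    p (h + t) k n ≤ ∑ m ∈ s, p h k m * p t m n + (1 - ∑ m ∈ s, p h k m) := by
  have h1 := (hp.hasSum_one h k).sub (hp.chapmanKolmogorov h t k n)
  have h2 : ∑ m ∈ s, (p h k m - p h k m * p t m n) ≤ 1 - p (h + t) k n :=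
    sum_le_hasSum s (fun m _ => by nlinarith [hp.nonneg h k m, hp.le_one t m n]) h1
  rw [Finset.sum_sub_distrib] at h2
  linarith

lemma pow_le (t : ℝ≥0) (k : ℤ) (j : ℕ) : p t k k ^ j ≤ p (j * t) k k := by
  induction j with
  | zero => simp [hp.zero]
  | succ j ih =>
    have h1 := hp.sum_mul_le (j * t) t k k {k}
    rw [Finset.sum_singleton] at h1
    rw [pow_succ]
    push_cast
    rw [add_mul, one_mul]
    exact (mul_le_mul_of_nonneg_right ih (hp.nonneg t k k)).trans h1

variable {G : ℤ → ℤ → ℝ} (hG : HasGenerator p G)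
include hG

/-- Staying at `k` at each of the times `t / j, 2 t / j, …` is one way to be there at time `t`, so
`p (t / j) k k ^ j ≤ p t k k`. The generator limit at `0` identifies the limit of the left side as
`j → ∞`. -/
lemma exp_le (t : ℝ≥0) (k : ℤ) : Real.exp (G k k * t) ≤ p t k k := by
  rcases eq_or_ne t 0 with rfl | ht
  · simp [hp.zero]
  have ht' : 0 < t := pos_iff_ne_zero.mpr ht
  have h0 : Tendsto (fun j : ℕ => t / (j : ℝ≥0)) atTop (𝓝[>] 0) := by
    refine tendsto_nhdsWithin_iff.mpr ⟨?_, ?_⟩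
    · rw [← NNReal.tendsto_coe]
      simpa using tendsto_const_div_atTop_nhds_zero_nat (t : ℝ)
    · filter_upwards [eventually_gt_atTop 0] with j hj
      have : (0 : ℝ≥0) < j := by exact_mod_cast hj
      exact div_pos ht' this
  have h1 := ((hG k k).comp h0).mul_const (t : ℝ)
  have h2 : Tendsto (fun j : ℕ => (j : ℝ) * (p (t / j) k k - 1)) atTop (𝓝 (G k k * t)) := by
    refine h1.congr' ?_
    filter_upwards [eventually_gt_atTop 0] with j hj
    have hj' : (j : ℝ) ≠ 0 := by exact_mod_cast hj.ne'
    have ht2 : (t : ℝ) ≠ 0 := by exact_mod_cast ht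
    simp only [Function.comp, hp.zero, if_true, NNReal.coe_div, NNReal.coe_natCast]
    field_simp
  refine le_of_tendsto (Real.tendsto_one_add_pow_exp_of_tendsto h2) ?_
  filter_upwards [eventually_gt_atTop 0] with j hj
  have hj' : (j : ℝ≥0) ≠ 0 := by exact_mod_cast hj.ne'
  have := hp.pow_le (t / j) k j
  rwa [mul_div_cancel₀ t hj', ← add_sub_cancel 1 (p (t / j) k k)] at this

lemma one_sub_le (t : ℝ≥0) (k : ℤ) : 1 - p t k k ≤ -G k k * t := by
  have h1 := hp.exp_le hG t k
  have h2 := Real.add_one_le_exp (G k k * t)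
  linarith

/-- The extra time `h` is spent at the start: with probability at least `1 - q h` the chain is back
at `k` at its end, and then only `t` remains. -/
lemma abs_sub_le {q : ℝ} (k : ℤ) (hq : -q ≤ G k k) (h t : ℝ≥0) (n : ℤ) :
    |p (h + t) k n - p t k n| ≤ q * h := by
  have h1 := hp.one_sub_le hG h k
  have h2 := hp.sum_mul_le h t k n {k}
  have h3 := hp.le_sum_mul_add h t k n {k}
  rw [Finset.sum_singleton] at h2 h3
  rw [Finset.sum_singleton] at h3
  have h4 : 1 - p h k k ≤ q * h := by nlinarith [h.coe_nonneg]
  have h5 := hp.nonneg t k n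
  have h6 := hp.le_one t k n
  have h7 := hp.le_one h k k
  rw [abs_le]
  constructor <;> nlinarith

lemma continuous (k n : ℤ) : Continuous fun t => p t k n := by
  have hle : ∀ s t : ℝ≥0, s ≤ t → |p t k n - p s k n| ≤ -G k k * ((t : ℝ) - s) := by
    intro s t hst
    have := hp.abs_sub_le hG (q := -G k k) k (by simp) (t - s) s n
    rwa [tsub_add_cancel_of_le hst, NNReal.coe_sub hst] at this
  have hlip : ∀ s t : ℝ≥0, dist (p s k n) (p t k n) ≤ -G k k * dist s t := by
    intro s t
    rcases le_total s t with hst | hst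
    · rw [dist_comm, Real.dist_eq, dist_comm s t, NNReal.dist_eq,
        abs_of_nonneg (sub_nonneg.mpr (NNReal.coe_le_coe.mpr hst))]
      exact hle s t hst
    · rw [Real.dist_eq, NNReal.dist_eq,
        abs_of_nonneg (sub_nonneg.mpr (NNReal.coe_le_coe.mpr hst))]
      exact hle t s hst
  exact (LipschitzWith.of_dist_le' hlip).continuous

end IsTransitionFunction

/-! ### Uniformization of a generator with bounded rates. -/

/-- `G` is a conservative generator of finite range (from `k` only the states in `s k` are
reached), whose jump rates are bounded by `q`. -/
structure IsUniformizable (G : ℤ → ℤ → ℝ) (s : ℤ → Finset ℤ) (q : ℝ) : Prop where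
  mem : ∀ k, k ∈ s k
  sum_eq_zero : ∀ k, ∑ m ∈ s k, G k m = 0
  nonneg : ∀ k, ∀ m ∈ s k, m ≠ k → 0 ≤ G k m
  neg_le : ∀ k, -q ≤ G k k

/-- The operator `q I + G`, for a generator `G` of range `s`. -/
def jump (G : ℤ → ℤ → ℝ) (s : ℤ → Finset ℤ) (q : ℝ) (f : ℤ → ℝ) (k : ℤ) : ℝ :=
  q * f k + ∑ m ∈ s k, G k m * f m

namespace IsUniformizable

variable {G : ℤ → ℤ → ℝ} {s : ℤ → Finset ℤ} {q : ℝ} (hu : IsUniformizable G s q)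
include hu

/-- The entries of `q I + G` are nonnegative and its rows sum to `q`, so it has norm at most `q` on
bounded functions. -/
lemma sum_abs (k : ℤ) : q + G k k + ∑ m ∈ (s k).erase k, |G k m| = q := by
  have h1 := hu.sum_eq_zero k
  rw [← Finset.add_sum_erase _ _ (hu.mem k)] at h1
  have h2 : ∑ m ∈ (s k).erase k, |G k m| = ∑ m ∈ (s k).erase k, G k m :=
    Finset.sum_congr rfl fun m hm =>
      abs_of_nonneg (hu.nonneg k m (Finset.mem_of_mem_erase hm) (Finset.ne_of_mem_erase hm))
  linarith

lemma bound_nonneg : 0 ≤ q := by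
  have h1 := hu.sum_abs 0
  have h2 := hu.neg_le 0
  have h3 : 0 ≤ ∑ m ∈ (s 0).erase 0, |G 0 m| := Finset.sum_nonneg fun m _ => abs_nonneg _
  linarith

lemma jump_eq (f : ℤ → ℝ) (k : ℤ) :
    jump G s q f k = (q + G k k) * f k + ∑ m ∈ (s k).erase k, G k m * f m := by
  rw [jump, ← Finset.add_sum_erase _ _ (hu.mem k)]
  ring

lemma abs_jump_le {f : ℤ → ℝ} {M : ℝ} (hf : ∀ k, |f k| ≤ M) (k : ℤ) :
    |jump G s q f k| ≤ q * M := by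
  rw [hu.jump_eq]
  calc |(q + G k k) * f k + ∑ m ∈ (s k).erase k, G k m * f m|
      ≤ (q + G k k) * M + ∑ m ∈ (s k).erase k, |G k m| * M := by
        refine (abs_add_le _ _).trans (add_le_add ?_ ?_)
        · rw [abs_mul, abs_of_nonneg (by linarith [hu.neg_le k])]
          exact mul_le_mul_of_nonneg_left (hf k) (by linarith [hu.neg_le k])
        · refine (Finset.abs_sum_le_sum_abs _ _).trans (Finset.sum_le_sum fun m _ => ?_)
          rw [abs_mul]
          exact mul_le_mul_of_nonneg_left (hf m) (abs_nonneg _)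
    _ = (q + G k k + ∑ m ∈ (s k).erase k, |G k m|) * M := by
        rw [← Finset.sum_mul]; ring
    _ = q * M := by rw [hu.sum_abs]

lemma jump_nonneg {f : ℤ → ℝ} (hf : ∀ k, 0 ≤ f k) (k : ℤ) : 0 ≤ jump G s q f k := by
  rw [hu.jump_eq]
  refine add_nonneg (mul_nonneg (by linarith [hu.neg_le k]) (hf k))
    (Finset.sum_nonneg fun m hm => mul_nonneg ?_ (hf m))
  exact hu.nonneg k m (Finset.mem_of_mem_erase hm) (Finset.ne_of_mem_erase hm)

lemma iterate_jump_nonneg {f : ℤ → ℝ} (hf : ∀ k, 0 ≤ f k) (j : ℕ) (k : ℤ) :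
    0 ≤ (jump G s q)^[j] f k := by
  induction j generalizing k with
  | zero => exact hf k
  | succ j ih =>
    rw [Function.iterate_succ_apply']
    exact hu.jump_nonneg ih k

variable {p : ℝ≥0 → ℤ → ℤ → ℝ} (hp : IsTransitionFunction p) (hG : HasGenerator p G)
include hp hG

/-- Kolmogorov's backward equation, at the level of difference quotients. -/
lemma tendsto_slope (t : ℝ≥0) (k n : ℤ) :
    Tendsto (fun h : ℝ≥0 => (p (h + t) k n - p t k n) / (h : ℝ)) (𝓝[>] 0)
      (𝓝 (∑ m ∈ s k, G k m * p t m n)) := by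
  have h1 : Tendsto (fun h : ℝ≥0 => ∑ m ∈ s k, (p h k m - p 0 k m) / (h : ℝ) * p t m n) (𝓝[>] 0)
      (𝓝 (∑ m ∈ s k, G k m * p t m n)) :=
    tendsto_finsetSum _ fun m _ => (hG k m).mul_const _
  -- The row of `G` sums to zero over `s k`, so the mass outside `s k` at time `h` is `o(h)`. It
  -- bounds the error of truncating the Chapman-Kolmogorov sum to `s k`, and the difference quotient
  -- is squeezed.
  have h2 : Tendsto (fun h : ℝ≥0 => ∑ m ∈ s k, (p h k m - p 0 k m) / (h : ℝ)) (𝓝[>] 0)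
      (𝓝 0) := by
    rw [← hu.sum_eq_zero k]
    exact tendsto_finsetSum _ fun m _ => hG k m
  have h3 : Tendsto (fun h : ℝ≥0 => ∑ m ∈ s k, (p h k m - p 0 k m) / (h : ℝ) * p t m n -
      ∑ m ∈ s k, (p h k m - p 0 k m) / (h : ℝ)) (𝓝[>] 0)
      (𝓝 (∑ m ∈ s k, G k m * p t m n)) := by
    simpa using h1.sub h2
  have e1 : ∑ m ∈ s k, p 0 k m = 1 := by simp [hp.zero, hu.mem k]
  have e2 : ∑ m ∈ s k, p 0 k m * p t m n = p t k n := by simp [hp.zero, hu.mem k]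
  have e3 : ∀ h : ℝ≥0, ∑ m ∈ s k, (p h k m - p 0 k m) / (h : ℝ) * p t m n =
      (∑ m ∈ s k, p h k m * p t m n - p t k n) / h := by
    intro h
    rw [← e2, ← Finset.sum_sub_distrib, Finset.sum_div]
    exact Finset.sum_congr rfl fun m _ => by ring
  have e4 : ∀ h : ℝ≥0, ∑ m ∈ s k, (p h k m - p 0 k m) / (h : ℝ) =
      (∑ m ∈ s k, p h k m - 1) / h := by
    intro h
    rw [← e1, ← Finset.sum_sub_distrib, Finset.sum_div]
  refine tendsto_of_tendsto_of_tendsto_of_le_of_le h1 h3 (fun h => ?_) (fun h => ?_)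
  · simp only [e3]
    exact div_le_div_of_nonneg_right (by linarith [hp.sum_mul_le h t k n (s k)]) h.coe_nonneg
  · simp only [e3, e4, ← sub_div]
    exact div_le_div_of_nonneg_right (by linarith [hp.le_sum_mul_add h t k n (s k)]) h.coe_nonneg

lemma hasDerivWithinAt (k n : ℤ) {x : ℝ} (hx : 0 ≤ x) :
    HasDerivWithinAt (fun y : ℝ => p y.toNNReal k n) (∑ m ∈ s k, G k m * p x.toNNReal m n)
      (Set.Ici x) x := by
  rw [← hasDerivWithinAt_Ioi_iff_Ici, hasDerivWithinAt_iff_tendsto_slope' (by simp)]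
  have h0 : Tendsto (fun y : ℝ => (y - x).toNNReal) (𝓝[>] x) (𝓝[>] 0) := by
    refine tendsto_nhdsWithin_iff.mpr ⟨?_, ?_⟩
    · have : Continuous fun y : ℝ => (y - x).toNNReal := by fun_prop
      have h1 := this.tendsto x
      simp only [sub_self, Real.toNNReal_zero] at h1
      exact h1.mono_left nhdsWithin_le_nhds
    · filter_upwards [self_mem_nhdsWithin] with y hy
      exact Real.toNNReal_pos.mpr (sub_pos.mpr hy)
  refine ((hu.tendsto_slope hp hG x.toNNReal k n).comp h0).congr' ?_
  filter_upwards [self_mem_nhdsWithin] with y hy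
  have hy' : 0 ≤ y - x := sub_nonneg.mpr (le_of_lt hy)
  rw [slope_def_field, Function.comp, ← Real.toNNReal_add hy' hx, sub_add_cancel,
    Real.coe_toNNReal _ hy']

/-- The function `u = exp (q x) p x` solves `u' = (q I + G) u`, so the right derivative of its
Taylor remainder of order `N + 1` is `q I + G` applied to the remainder of order `N`. As this
operator has norm at most `q`, the bound integrates from one order to the next. The endpoint `T` is
fixed so that the bound `exp (q T)` at order `0` is a constant. -/
lemma abs_remainder_le (n : ℤ) (T : ℝ) (N : ℕ) (k : ℤ) :
    ∀ x ∈ Set.Icc 0 T, |Real.exp (q * x) * p x.toNNReal k n -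
      ∑ j ∈ Finset.range N, x ^ j / (j.factorial : ℝ) * (jump G s q)^[j] (fun m => p 0 m n) k|
      ≤ Real.exp (q * T) * ((q * x) ^ N / N.factorial) := by
  induction N generalizing k with
  | zero =>
    intro x hx
    have h1 := hp.nonneg x.toNNReal k n
    have h2 := hp.le_one x.toNNReal k n
    simp only [Finset.range_zero, Finset.sum_empty, sub_zero, pow_zero, Nat.factorial_zero,
      Nat.cast_one, div_one, mul_one]
    rw [abs_mul, abs_of_nonneg h1, Real.abs_exp]
    calc Real.exp (q * x) * p x.toNNReal k n ≤ Real.exp (q * x) * 1 := by gcongr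
      _ ≤ Real.exp (q * T) := by
        rw [mul_one]
        exact Real.exp_le_exp.mpr (mul_le_mul_of_nonneg_left hx.2 hu.bound_nonneg)
  | succ N ih =>
    set u : ℤ → ℝ → ℝ := fun m x => Real.exp (q * x) * p x.toNNReal m n with hu_def
    set r : ℤ → ℝ → ℝ := fun m x => u m x - ∑ j ∈ Finset.range N,
      x ^ j / (j.factorial : ℝ) * (jump G s q)^[j] (fun m => p 0 m n) m with hr_def
    have hcont : ContinuousOn (fun x => u k x - ∑ j ∈ Finset.range (N + 1),
        x ^ j / (j.factorial : ℝ) * (jump G s q)^[j] (fun m => p 0 m n) k) (Set.Icc 0 T) := by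
      have h1 := (hp.continuous hG k n).comp continuous_real_toNNReal
      have h2 : Continuous (u k) := (by fun_prop : Continuous fun x => Real.exp (q * x)).mul h1
      exact (h2.sub (by fun_prop)).continuousOn
    have hpoly : ∀ x, HasDerivAt (fun x : ℝ => ∑ j ∈ Finset.range (N + 1),
        x ^ j / (j.factorial : ℝ) * (jump G s q)^[j] (fun m => p 0 m n) k)
        (∑ j ∈ Finset.range N,
          x ^ j / (j.factorial : ℝ) * (jump G s q)^[j + 1] (fun m => p 0 m n) k) x := by
      intro x
      simp_rw [Finset.sum_range_succ']
      simp only [pow_zero, Nat.factorial_zero, Nat.cast_one, div_one, one_mul]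
      refine HasDerivAt.add_const _ (HasDerivAt.fun_sum fun j _ => ?_)
      have h1 := ((hasDerivAt_pow (j + 1) x).div_const ((j + 1).factorial : ℝ)).mul_const
        ((jump G s q)^[j + 1] (fun m => p 0 m n) k)
      refine h1.congr_deriv ?_
      have h2 : (j.factorial : ℝ) ≠ 0 := by exact_mod_cast j.factorial_ne_zero
      have h3 : ((j : ℝ) + 1) ≠ 0 := by positivity
      rw [Nat.factorial_succ]
      push_cast
      field_simp
    have hderiv : ∀ x ∈ Set.Ico 0 T, HasDerivWithinAt (fun x => u k x - ∑ j ∈ Finset.range (N + 1),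
        x ^ j / (j.factorial : ℝ) * (jump G s q)^[j] (fun m => p 0 m n) k)
        (jump G s q (fun m => r m x) k) (Set.Ici x) x := by
      intro x hx
      have h1 : HasDerivAt (fun x => Real.exp (q * x)) (Real.exp (q * x) * q) x := by
        simpa using ((hasDerivAt_id x).const_mul q).exp
      have h2 := (h1.hasDerivWithinAt (s := Set.Ici x)).mul
        (hu.hasDerivWithinAt hp hG k n hx.1)
      refine (h2.sub (hpoly x).hasDerivWithinAt).congr_deriv ?_
      simp only [hr_def, hu_def, jump, Function.iterate_succ_apply', mul_sub,
        Finset.sum_sub_distrib, mul_add, Finset.sum_add_distrib, Finset.mul_sum]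
      rw [Finset.sum_comm (s := s k) (t := Finset.range N)]
      have e1 : ∀ m, Real.exp (q * x) * (G k m * p x.toNNReal m n) =
        G k m * (Real.exp (q * x) * p x.toNNReal m n) := fun m => by ring
      have e2 : ∀ (j : ℕ) (a b : ℝ), x ^ j / (j.factorial : ℝ) * (b * a) =
        b * (x ^ j / (j.factorial : ℝ) * a) := fun j a b => by ring
      simp only [e1, e2]
      ring
    have hbound : ∀ x, HasDerivAt
        (fun x : ℝ => Real.exp (q * T) * ((q * x) ^ (N + 1) / (N + 1).factorial))
        (q * (Real.exp (q * T) * ((q * x) ^ N / N.factorial))) x := by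
      intro x
      have h0 : HasDerivAt (fun x : ℝ => q * x) q x := by
        simpa using (hasDerivAt_id x).const_mul q
      have h1 := ((h0.pow (N + 1)).div_const ((N + 1).factorial : ℝ)).const_mul (Real.exp (q * T))
      refine h1.congr_deriv ?_
      have h2 : (N.factorial : ℝ) ≠ 0 := by exact_mod_cast N.factorial_ne_zero
      have h3 : ((N : ℝ) + 1) ≠ 0 := by positivity
      rw [Nat.factorial_succ]
      push_cast
      field_simp
    intro x hx
    refine image_norm_le_of_norm_deriv_right_le_deriv_boundary hcont hderiv ?_ hbound ?_ hx
    · rw [Finset.sum_range_succ']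
      simp [hu_def]
    · intro y hy
      exact hu.abs_jump_le (fun m => ih m y ⟨hy.1, hy.2.le⟩) k

/-- Uniformization: a transition function with bounded generator `G` is `exp (t G)`. -/
lemma hasSum_uniformization (t : ℝ≥0) (k n : ℤ) :
    HasSum (fun j : ℕ => Real.exp (-(q * t)) * ((t : ℝ) ^ j / (j.factorial : ℝ) *
      (jump G s q)^[j] (fun m => if m = n then 1 else 0) k)) (p t k n) := by
  have h0 : (fun m => p 0 m n) = fun m => if m = n then (1 : ℝ) else 0 := by
    funext m; rw [hp.zero]
  have h1 : HasSum (fun j : ℕ => (t : ℝ) ^ j / (j.factorial : ℝ) *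
      (jump G s q)^[j] (fun m => p 0 m n) k) (Real.exp (q * t) * p t k n) := by
    rw [hasSum_iff_tendsto_nat_of_nonneg]
    · rw [tendsto_iff_dist_tendsto_zero]
      have hlim := (FloorSemiring.tendsto_pow_div_factorial_atTop (q * (t : ℝ))).const_mul
        (Real.exp (q * t))
      rw [mul_zero] at hlim
      refine squeeze_zero (fun _ => dist_nonneg) (fun N => ?_) hlim
      have := hu.abs_remainder_le hp hG n t N k t ⟨t.coe_nonneg, le_rfl⟩
      rwa [Real.toNNReal_coe, ← Real.dist_eq, dist_comm] at this
    · intro j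
      exact mul_nonneg (by positivity)
        (hu.iterate_jump_nonneg (fun m => hp.nonneg 0 m n) j k)
  have h2 := h1.mul_left (Real.exp (-(q * t)))
  rwa [← mul_assoc, ← Real.exp_add, neg_add_cancel, Real.exp_zero, one_mul, h0] at h2

end IsUniformizable

/-! ### The generating function of the alternating chain -/

/-- The range of the generator of a nearest neighbour chain. -/
def neighbours (k : ℤ) : Finset ℤ := {k - 1, k, k + 1}

lemma sum_neighbours (k : ℤ) (f : ℤ → ℝ) :
    ∑ m ∈ neighbours k, f m = f (k - 1) + f k + f (k + 1) := by
  rw [neighbours, Finset.sum_insert (by simp; omega), Finset.sum_insert (by simp),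
    Finset.sum_singleton]
  ring

lemma generator_self (α₁ α₂ β₁ β₂ : ℝ) (k : ℤ) :
    generator α₁ α₂ β₁ β₂ k k = if Even k then -(α₁ + α₂) else -(β₁ + β₂) := by
  simp [generator]

lemma generator_add_one (α₁ α₂ β₁ β₂ : ℝ) (k : ℤ) :
    generator α₁ α₂ β₁ β₂ k (k + 1) = if Even k then α₁ else β₁ := by
  simp [generator]

lemma generator_sub_one (α₁ α₂ β₁ β₂ : ℝ) (k : ℤ) :
    generator α₁ α₂ β₁ β₂ k (k - 1) = if Even k then α₂ else β₂ := by
  have : k - 1 ≠ k + 1 := by omega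
  simp [generator, this]

/-- Each application of `jump` is a finite sum, so expanding `f` in point masses commutes with it.
No bound on `f` is needed, which matters for `z ^ n`. -/
lemma hasSum_iterate_jump (G : ℤ → ℤ → ℝ) (s : ℤ → Finset ℤ) (q : ℝ) (f : ℤ → ℝ)
    (j : ℕ) (k : ℤ) :
    HasSum (fun n => f n * (jump G s q)^[j] (fun m => if m = n then 1 else 0) k)
      ((jump G s q)^[j] f k) := by
  induction j generalizing k with
  | zero =>
    simp only [Function.iterate_zero, id, mul_ite, mul_one, mul_zero, eq_comm (a := k)]
    refine (hasSum_ite_eq k (f k)).congr_fun fun n => ?_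
    split_ifs with hn
    · rw [hn]
    · rfl
  | succ j ih =>
    simp only [Function.iterate_succ_apply']
    have h1 := ((ih k).mul_left q).add
      (hasSum_sum (s := s k) fun m _ => (ih m).mul_left (G k m))
    refine h1.congr_fun ?_
    intro n
    simp only [jump, mul_add, Finset.mul_sum]
    congr 1
    · ring
    · exact Finset.sum_congr rfl fun m _ => by ring

section

variable {α₁ α₂ β₁ β₂ : ℝ}

lemma isUniformizable_generator (hα₁ : 0 < α₁) (hα₂ : 0 < α₂) (hβ₁ : 0 < β₁) (hβ₂ : 0 < β₂) :
    IsUniformizable (generator α₁ α₂ β₁ β₂) neighbours (α₁ + α₂ + β₁ + β₂) where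
  mem k := by simp [neighbours]
  sum_eq_zero k := by
    rw [sum_neighbours, generator_self, generator_add_one, generator_sub_one]
    split_ifs <;> ring
  nonneg k m _ hmk := by
    rw [generator, if_neg hmk]
    split_ifs <;> linarith
  neg_le k := by
    rw [generator_self]
    split_ifs <;> linarith

/-- With `d = (α₁ + α₂ - (β₁ + β₂)) z / 2`, `A = α₁ z ^ 2 + α₂` and `B = β₁ z ^ 2 + β₂`, the
coefficient `c` is `A - d` at even and `B + d` at odd states, and the eigenvalue equation reduces to
`(w + d) (w - d) = A B`. Both roots `w = ± h` are used. -/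
lemma jump_eigenfunction {z w : ℝ} (hz : 0 < z) (q : ℝ)
    (hw : w ^ 2 = ((α₁ + α₂ - (β₁ + β₂)) * z / 2) ^ 2 +
      (β₁ * z ^ 2 + β₂) * (α₁ * z ^ 2 + α₂)) (k : ℤ) :
    jump (generator α₁ α₂ β₁ β₂) neighbours q (fun m => z ^ m * (w + c α₁ α₂ β₁ β₂ m z)) k =
      (q + (-((α₁ + α₂ + β₁ + β₂) / 2) + w / z)) * (z ^ k * (w + c α₁ α₂ β₁ β₂ k z)) := by
  rw [jump, sum_neighbours, generator_self, generator_add_one, generator_sub_one,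
    zpow_add_one₀ hz.ne', zpow_sub_one₀ hz.ne']
  have hzk : (z ^ k : ℝ) ≠ 0 := (zpow_pos hz k).ne'
  generalize (z ^ k : ℝ) = y at hzk
  by_cases hk : Even k
  · have h1 : ¬ Even (k + 1) := by simpa [Int.even_add_one] using hk
    have h2 : ¬ Even (k - 1) := by simpa [Int.even_sub_one] using hk
    simp only [c, hk, h1, h2, if_true, if_false]
    field_simp
    linear_combination (-4) * hw
  · have h1 : Even (k + 1) := by simpa [Int.even_add_one] using hk
    have h2 : Even (k - 1) := by simpa [Int.even_sub_one] using hk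
    simp only [c, hk, h1, h2, if_true, if_false]
    field_simp
    linear_combination (-4) * hw

variable (hα₁ : 0 < α₁) (hα₂ : 0 < α₂) (hβ₁ : 0 < β₁) (hβ₂ : 0 < β₂) {z : ℝ} (hz : 0 < z)
include hα₁ hα₂ hβ₁ hβ₂ hz

lemma h_sq : h α₁ α₂ β₁ β₂ z ^ 2 = ((α₁ + α₂ - (β₁ + β₂)) * z / 2) ^ 2 +
    (β₁ * z ^ 2 + β₂) * (α₁ * z ^ 2 + α₂) := by
  rw [h, mul_pow, Real.sq_sqrt (by positivity)]
  ring

lemma h_pos : 0 < h α₁ α₂ β₁ β₂ z := by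
  rw [h]
  have : 0 < √((α₁ + α₂ - (β₁ + β₂)) ^ 2 * z ^ 2 + 4 * (β₁ * z ^ 2 + β₂) * (α₁ * z ^ 2 + α₂)) :=
    Real.sqrt_pos.mpr (by positivity)
  linarith

/-- By `h_sq`, `h` dominates the absolute value of the term of `c` that can be negative. This makes
the weight of `exp (x hPlus)` in `chainPgf` positive. -/
lemma h_add_c_pos (k : ℤ) : 0 < h α₁ α₂ β₁ β₂ z + c α₁ α₂ β₁ β₂ k z := by
  have h1 := h_sq hα₁ hα₂ hβ₁ hβ₂ hz
  have h2 := h_pos hα₁ hα₂ hβ₁ hβ₂ hz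
  have h3 : 0 < (β₁ * z ^ 2 + β₂) * (α₁ * z ^ 2 + α₂) := by positivity
  have h4 := abs_le_of_sq_le_sq' (a := (α₁ + α₂ - (β₁ + β₂)) * z / 2) (by linarith) h2.le
  have h5 : 0 < α₁ * z ^ 2 := by positivity
  have h6 : 0 < β₁ * z ^ 2 := by positivity
  rw [c]
  split_ifs <;> linarith [h4.1, h4.2]

lemma hMinus_neg : hMinus α₁ α₂ β₁ β₂ z < 0 := by
  have h1 : 0 < h α₁ α₂ β₁ β₂ z / z := div_pos (h_pos hα₁ hα₂ hβ₁ hβ₂ hz) hz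
  rw [hMinus]
  linarith

end

/-- The generating function at `z` of the chain started at `k`, at time `x`. -/
noncomputable def chainPgf (α₁ α₂ β₁ β₂ : ℝ) (k : ℤ) (z x : ℝ) : ℝ :=
  z ^ k * ((Real.exp (x * hPlus α₁ α₂ β₁ β₂ z) + Real.exp (x * hMinus α₁ α₂ β₁ β₂ z)) / 2 +
    c α₁ α₂ β₁ β₂ k z / h α₁ α₂ β₁ β₂ z *
      ((Real.exp (x * hPlus α₁ α₂ β₁ β₂ z) - Real.exp (x * hMinus α₁ α₂ β₁ β₂ z)) / 2))

section

variable {α₁ α₂ β₁ β₂ : ℝ} (hα₁ : 0 < α₁) (hα₂ : 0 < α₂) (hβ₁ : 0 < β₁) (hβ₂ : 0 < β₂)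
  {z : ℝ} (hz : 0 < z)
include hα₁ hα₂ hβ₁ hβ₂ hz

lemma iterate_jump_zpow (q : ℝ) (j : ℕ) (k : ℤ) :
    (jump (generator α₁ α₂ β₁ β₂) neighbours q)^[j] (fun m => z ^ m) k =
      z ^ k * (((q + hPlus α₁ α₂ β₁ β₂ z) ^ j + (q + hMinus α₁ α₂ β₁ β₂ z) ^ j) / 2 +
        c α₁ α₂ β₁ β₂ k z / h α₁ α₂ β₁ β₂ z *
          (((q + hPlus α₁ α₂ β₁ β₂ z) ^ j - (q + hMinus α₁ α₂ β₁ β₂ z) ^ j) / 2)) := by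
  have h0 := (h_pos hα₁ hα₂ hβ₁ hβ₂ hz).ne'
  have hsq := h_sq hα₁ hα₂ hβ₁ hβ₂ hz
  induction j generalizing k with
  | zero => simp
  | succ j ih =>
    have hp := jump_eigenfunction hz q hsq k
    have hm := jump_eigenfunction hz q (w := -h α₁ α₂ β₁ β₂ z) (by rw [neg_sq]; exact hsq) k
    rw [neg_div, ← sub_eq_add_neg, ← hMinus] at hm
    rw [← hPlus] at hp
    rw [Function.iterate_succ_apply', jump, sum_neighbours]
    rw [jump, sum_neighbours] at hp hm
    simp only [ih]
    generalize hPlus α₁ α₂ β₁ β₂ z = a at *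
    generalize hMinus α₁ α₂ β₁ β₂ z = b at *
    generalize h α₁ α₂ β₁ β₂ z = w at *
    -- Splitting along the eigenfunctions rests on `2 w z ^ m = z ^ m (w + c) - z ^ m (-w + c)`.
    have e : ∀ m : ℤ, z ^ m * (((q + a) ^ j + (q + b) ^ j) / 2 +
        c α₁ α₂ β₁ β₂ m z / w * (((q + a) ^ j - (q + b) ^ j) / 2)) =
        (q + a) ^ j / (2 * w) * (z ^ m * (w + c α₁ α₂ β₁ β₂ m z)) -
        (q + b) ^ j / (2 * w) * (z ^ m * (-w + c α₁ α₂ β₁ β₂ m z)) := by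
      intro m
      field_simp
      ring
    have e' : z ^ k * (((q + a) ^ (j + 1) + (q + b) ^ (j + 1)) / 2 +
        c α₁ α₂ β₁ β₂ k z / w * (((q + a) ^ (j + 1) - (q + b) ^ (j + 1)) / 2)) =
        (q + a) ^ j / (2 * w) * ((q + a) * (z ^ k * (w + c α₁ α₂ β₁ β₂ k z))) -
        (q + b) ^ j / (2 * w) * ((q + b) * (z ^ k * (-w + c α₁ α₂ β₁ β₂ k z))) := by
      field_simp
      ring
    rw [e', e, e, e, ← hp, ← hm]
    ring

lemma hasSum_exp_chainPgf (q t : ℝ) (k : ℤ) :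
    HasSum (fun j : ℕ => Real.exp (-(q * t)) * (t ^ j / (j.factorial : ℝ) *
      (jump (generator α₁ α₂ β₁ β₂) neighbours q)^[j] (fun m => z ^ m) k))
      (chainPgf α₁ α₂ β₁ β₂ k z t) := by
  have hexp : ∀ a : ℝ, HasSum (fun j : ℕ => Real.exp (-(q * t)) *
      ((t * (q + a)) ^ j / (j.factorial : ℝ))) (Real.exp (t * a)) := by
    intro a
    have h1 := (NormedSpace.expSeries_div_hasSum_exp (t * (q + a))).mul_left
      (Real.exp (-(q * t)))
    have e : t * a = -(q * t) + t * (q + a) := by ring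
    rw [e, Real.exp_add, Real.exp_eq_exp_ℝ]
    rwa [Real.exp_eq_exp_ℝ] at h1
  have hp := hexp (hPlus α₁ α₂ β₁ β₂ z)
  have hm := hexp (hMinus α₁ α₂ β₁ β₂ z)
  have h1 := (((hp.add hm).div_const 2).add (((hp.sub hm).div_const 2).mul_left
    (c α₁ α₂ β₁ β₂ k z / h α₁ α₂ β₁ β₂ z))).mul_left (z ^ k)
  refine h1.congr_fun fun j => ?_
  rw [iterate_jump_zpow hα₁ hα₂ hβ₁ hβ₂ hz, mul_pow, mul_pow]
  ring

lemma tsum_transition_eq {p : ℝ≥0 → ℤ → ℤ → ℝ} (hp : IsTransitionFunction p)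
    (hG : HasGenerator p (generator α₁ α₂ β₁ β₂)) (t : ℝ≥0) (k : ℤ) :
    ∑' n : ℤ, ENNReal.ofReal (z ^ n) * ENNReal.ofReal (p t k n) =
      ENNReal.ofReal (chainPgf α₁ α₂ β₁ β₂ k z t) := by
  have hu := isUniformizable_generator hα₁ hα₂ hβ₁ hβ₂
  set q := α₁ + α₂ + β₁ + β₂
  have hnn : ∀ (n : ℤ) (j : ℕ), 0 ≤ (jump (generator α₁ α₂ β₁ β₂) neighbours q)^[j]
      (fun m => if m = n then 1 else 0) k := fun n j =>
    hu.iterate_jump_nonneg (fun m => by split_ifs <;> norm_num) j k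
  have hzn : ∀ n : ℤ, 0 ≤ z ^ n := fun n => (zpow_pos hz n).le
  have h1 : ∀ n : ℤ, ENNReal.ofReal (z ^ n) * ENNReal.ofReal (p t k n) =
      ∑' j : ℕ, ENNReal.ofReal (Real.exp (-(q * t)) * ((t : ℝ) ^ j / (j.factorial : ℝ) *
        (z ^ n * (jump (generator α₁ α₂ β₁ β₂) neighbours q)^[j]
          (fun m => if m = n then 1 else 0) k))) := by
    intro n
    have h2 := (hu.hasSum_uniformization hp hG t k n).mul_left (z ^ n)
    rw [← ENNReal.ofReal_mul (hzn n), ← h2.tsum_eq, ENNReal.ofReal_tsum_of_nonneg _ h2.summable]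
    · exact tsum_congr fun j => congrArg _ (by ring)
    · intro j
      have := hnn n j
      have := hzn n
      positivity
  have h3 := hasSum_exp_chainPgf hα₁ hα₂ hβ₁ hβ₂ hz q t k
  simp_rw [h1]
  rw [ENNReal.tsum_comm, ← h3.tsum_eq, ENNReal.ofReal_tsum_of_nonneg _ h3.summable]
  · refine tsum_congr fun j => ?_
    have h4 := ((hasSum_iterate_jump (generator α₁ α₂ β₁ β₂) neighbours q (fun m => z ^ m)
      j k).mul_left ((t : ℝ) ^ j / (j.factorial : ℝ))).mul_left (Real.exp (-(q * t)))
    rw [← h4.tsum_eq, ENNReal.ofReal_tsum_of_nonneg _ h4.summable]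
    intro n
    have := hnn n j
    have := hzn n
    positivity
  · intro j
    have := hu.iterate_jump_nonneg hzn j k
    positivity

end

/-! ### The law of the time-changed chain -/

/-- The right endpoint of the dyadic interval of level `m` with index `j`. -/
noncomputable def dyadic (m j : ℕ) : ℝ≥0 := (j + 1) / 2 ^ m

/-- The right endpoint of the dyadic interval of level `m` that contains `x`. -/
noncomputable def dyadicAbove (m : ℕ) (x : ℝ≥0) : ℝ≥0 := dyadic m ⌊x * 2 ^ m⌋₊

lemma le_dyadicAbove (m : ℕ) (x : ℝ≥0) : x ≤ dyadicAbove m x := by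
  rw [dyadicAbove, dyadic, le_div_iff₀ (by positivity)]
  exact (Nat.lt_floor_add_one _).le

lemma tendsto_dyadicAbove (x : ℝ≥0) :
    Tendsto (fun m => dyadicAbove m x) atTop (𝓝[≥] x) := by
  refine tendsto_nhdsWithin_iff.mpr ⟨?_, Eventually.of_forall fun m => le_dyadicAbove m x⟩
  have h1 : Tendsto (fun m : ℕ => x + (1 / 2) ^ m) atTop (𝓝 x) := by
    have : Tendsto (fun m : ℕ => (1 / 2 : ℝ≥0) ^ m) atTop (𝓝 0) := by
      refine NNReal.tendsto_pow_atTop_nhds_zero_of_lt_one ?_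
      exact NNReal.half_lt_self one_ne_zero
    simpa using this.const_add x
  refine tendsto_of_tendsto_of_tendsto_of_le_of_le tendsto_const_nhds h1
    (fun m => le_dyadicAbove m x) (fun m => ?_)
  have h2 : (2 : ℝ≥0) ^ m ≠ 0 := by positivity
  rw [dyadicAbove, dyadic, div_le_iff₀ (by positivity), add_mul, ← mul_pow]
  simp only [one_div, ne_eq, OfNat.ofNat_ne_zero, not_false_eq_true, inv_mul_cancel₀, one_pow]
  gcongr
  exact Nat.floor_le zero_le

lemma measurable_dyadic_floor (m : ℕ) : Measurable fun x : ℝ≥0 => ⌊x * 2 ^ m⌋₊ :=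
  Nat.measurable_floor.comp (measurable_id.mul_const _)

section

variable {Ω : Type*} [MeasurableSpace Ω] {P : Measure Ω}
  {X : ℝ≥0 → Ω → ℤ} {S : ℝ≥0 → Ω → ℝ≥0}

/-- The dyadic points approach `x` from the right, and convergence in the discrete space `ℤ` means
being eventually constant. -/
lemma eventually_dyadicAbove_eq {x : ℝ≥0} {f : ℝ≥0 → ℤ}
    (hf : ContinuousWithinAt f (Set.Ici x) x) :
    ∀ᶠ m in atTop, f (dyadicAbove m x) = f x := by
  have h1 : Tendsto (fun m => f (dyadicAbove m x)) atTop (𝓝 (f x)) :=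
    hf.tendsto.comp (tendsto_dyadicAbove x)
  rwa [nhds_discrete, tendsto_pure] at h1

lemma measurable_comp_nat {Y : ℕ → Ω → ℤ} (hY : ∀ j, Measurable (Y j)) {N : Ω → ℕ}
    (hN : Measurable N) : Measurable fun ω => Y (N ω) ω := by
  have h1 : Measurable fun y : Ω × ℕ => Y y.2 y.1 := measurable_from_prod_countable_left hY
  exact h1.comp (measurable_id.prodMk hN)

lemma measurable_dyadicAbove_comp (hX : ∀ t, Measurable (X t)) {T : Ω → ℝ≥0} (hT : Measurable T)
    (m : ℕ) : Measurable fun ω => X (dyadicAbove m (T ω)) ω := by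
  exact measurable_comp_nat (fun j => hX (dyadic m j)) ((measurable_dyadic_floor m).comp hT)

variable (hX : ∀ t, Measurable (X t))
  (hrc : ∀ᵐ ω ∂P, ∀ t, ContinuousWithinAt (fun s => X s ω) (Set.Ici t) t)
include hX hrc

lemma aemeasurable_comp {T : Ω → ℝ≥0} (hT : Measurable T) :
    AEMeasurable (fun ω => X (T ω) ω) P := by
  refine aemeasurable_of_tendsto_metrizable_ae atTop
    (fun m => (measurable_dyadicAbove_comp hX hT m).aemeasurable) ?_
  filter_upwards [hrc] with ω hω
  exact tendsto_const_nhds.congr'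
    ((eventually_dyadicAbove_eq (hω (T ω))).mono fun m hm => hm.symm)

variable [IsProbabilityMeasure P]

/-- The joint law of `X 0` and of `X` at an independent random time `T`. -/
lemma measure_comp_indep {p : ℝ≥0 → ℤ → ℤ → ℝ} {T : Ω → ℝ≥0} (hT : Measurable T)
    (hind : IndepFun (fun ω t => X t ω) T P) {k n : ℤ}
    (hle : ∀ t, p t k n ≤ 1) (hcont : Continuous fun t => p t k n)
    (hmarkov : ∀ t, P {ω | X 0 ω = k ∧ X t ω = n} =
      P {ω | X 0 ω = k} * ENNReal.ofReal (p t k n)) :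
    P {ω | X 0 ω = k ∧ X (T ω) ω = n} =
      P {ω | X 0 ω = k} * ∫⁻ x, ENNReal.ofReal (p x k n) ∂(P.map T) := by
  have hk : MeasurableSet {ω | X 0 ω = k} := hX 0 (measurableSet_singleton k)
  -- The discretized time has countably many values. On each of them independence factors the event,
  -- and the Markov property applies at a deterministic time.
  have hdisc : ∀ m, P {ω | X 0 ω = k ∧ X (dyadicAbove m (T ω)) ω = n} =
      P {ω | X 0 ω = k} * ∫⁻ x, ENNReal.ofReal (p (dyadicAbove m x) k n) ∂(P.map T) := by
    intro m
    have e1 : {ω | X 0 ω = k ∧ X (dyadicAbove m (T ω)) ω = n} =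
        ⋃ j : ℕ, {ω | X 0 ω = k ∧ X (dyadic m j) ω = n} ∩ {ω | ⌊T ω * 2 ^ m⌋₊ = j} := by
      ext ω
      simp [dyadicAbove]
    have hfl : Measurable fun ω => ⌊T ω * 2 ^ m⌋₊ := (measurable_dyadic_floor m).comp hT
    have e2 : ∀ j : ℕ, P ({ω | X 0 ω = k ∧ X (dyadic m j) ω = n} ∩ {ω | ⌊T ω * 2 ^ m⌋₊ = j}) =
        P {ω | X 0 ω = k} * (ENNReal.ofReal (p (dyadic m j) k n) *
          (P.map fun ω => ⌊T ω * 2 ^ m⌋₊) {j}) := by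
      intro j
      have hA : MeasurableSet {f : ℝ≥0 → ℤ | f 0 = k ∧ f (dyadic m j) = n} :=
        (measurableSet_eq_fun (measurable_pi_apply 0) measurable_const).inter
          (measurableSet_eq_fun (measurable_pi_apply (dyadic m j)) measurable_const)
      have hB : MeasurableSet {x : ℝ≥0 | ⌊x * 2 ^ m⌋₊ = j} :=
        measurable_dyadic_floor m (measurableSet_singleton j)
      have h1 := hind.measure_inter_preimage_eq_mul _ _ hA hB
      rw [Measure.map_apply hfl (measurableSet_singleton j), ← mul_assoc, ← hmarkov]
      exact h1
    rw [e1, measure_iUnion]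
    · simp_rw [e2]
      rw [ENNReal.tsum_mul_left, ← lintegral_countable' (fun j => ENNReal.ofReal (p (dyadic m j) k n)),
        lintegral_map (measurable_of_countable _) hfl]
      congr 1
      have hm : Measurable fun x => ENNReal.ofReal (p (dyadicAbove m x) k n) :=
        (measurable_of_countable fun j => ENNReal.ofReal (p (dyadic m j) k n)).comp
          (measurable_dyadic_floor m)
      rw [lintegral_map hm hT]
      rfl
    · intro i j hij
      refine Set.disjoint_left.mpr fun ω h1 h2 => hij ?_
      exact h1.2.symm.trans h2.2
    · intro j
      exact (hk.inter (hX _ (measurableSet_singleton n))).inter (hfl (measurableSet_singleton j))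
  have hlim1 : Tendsto (fun m => P {ω | X 0 ω = k ∧ X (dyadicAbove m (T ω)) ω = n}) atTop
      (𝓝 (P {ω | X 0 ω = k ∧ X (T ω) ω = n})) := by
    -- `X` at time `T` is only known to be a.e. measurable, so a measurable version replaces it.
    set Y := (aemeasurable_comp hX hrc hT).mk _ with hY
    have hYm : Measurable Y := (aemeasurable_comp hX hrc hT).measurable_mk
    have hYe : ∀ᵐ ω ∂P, X (T ω) ω = Y ω := (aemeasurable_comp hX hrc hT).ae_eq_mk
    have e : P {ω | X 0 ω = k ∧ X (T ω) ω = n} = P {ω | X 0 ω = k ∧ Y ω = n} := by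
      refine measure_congr ?_
      filter_upwards [hYe] with ω hω
      exact congrArg (fun y => X 0 ω = k ∧ y = n) hω
    rw [e]
    refine tendsto_measure_of_ae_tendsto_indicator_of_isFiniteMeasure atTop
      (hk.inter (hYm (measurableSet_singleton n)))
      (fun m => hk.inter (measurable_dyadicAbove_comp hX hT m (measurableSet_singleton n))) ?_
    filter_upwards [hrc, hYe] with ω h1 h2
    filter_upwards [eventually_dyadicAbove_eq (h1 (T ω))] with m hm
    rw [hm, h2]
  have hlim2 : Tendsto (fun m => ∫⁻ x, ENNReal.ofReal (p (dyadicAbove m x) k n) ∂(P.map T)) atTop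
      (𝓝 (∫⁻ x, ENNReal.ofReal (p x k n) ∂(P.map T))) := by
    have : IsProbabilityMeasure (P.map T) := Measure.isProbabilityMeasure_map hT.aemeasurable
    refine tendsto_lintegral_of_dominated_convergence (fun _ => 1) (fun m => ?_) (fun m => ?_)
      (by simp) (Eventually.of_forall fun x => ?_)
    · exact (measurable_of_countable fun j => ENNReal.ofReal (p (dyadic m j) k n)).comp
          (measurable_dyadic_floor m)
    · exact Eventually.of_forall fun x => by
        simpa using ENNReal.ofReal_le_ofReal (hle (dyadicAbove m x))
    · exact (ENNReal.continuous_ofReal.comp hcont).continuousAt.tendsto.comp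
        ((tendsto_dyadicAbove x).mono_right nhdsWithin_le_nhds)
  simp_rw [hdisc] at hlim1
  exact tendsto_nhds_unique hlim1
    (ENNReal.Tendsto.const_mul hlim2 (Or.inr (measure_ne_top _ _)))

end

lemma cond_congr_ae {Ω : Type*} [MeasurableSpace Ω] {P : Measure Ω} {s t : Set Ω}
    (hst : s =ᵐ[P] t) : cond P s = cond P t := by
  rw [ProbabilityTheory.cond, ProbabilityTheory.cond, measure_congr hst,
    Measure.restrict_congr_set hst]

lemma pgf_eq_tsum {Ω : Type*} [MeasurableSpace Ω] {P : Measure Ω} {Y : ℝ≥0 → Ω → ℤ} {t : ℝ≥0}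
    (hY : AEMeasurable (Y t) P) (k : ℤ) (z : ℝ) :
    pgf P Y k z t = ∑' n : ℤ, ENNReal.ofReal (z ^ n) * stateProb P Y k n t := by
  have hY' : AEMeasurable (Y t) (cond P {ω | Y 0 ω = k}) :=
    hY.mono_ac cond_absolutelyContinuous
  have h1 := lintegral_map' (f := fun n : ℤ => ENNReal.ofReal (z ^ n))
    (measurable_of_countable _).aemeasurable hY'
  rw [pgf, ← h1, lintegral_countable']
  refine tsum_congr fun n => ?_
  rw [Measure.map_apply_of_aemeasurable hY' (measurableSet_singleton n)]
  rfl

section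

variable {Ω : Type*} [MeasurableSpace Ω] {P : Measure Ω} {ν μ : ℝ}
  {X : ℝ≥0 → Ω → ℤ} {S : ℝ≥0 → Ω → ℝ≥0} {G : ℤ → ℤ → ℝ}

lemma timeChange_zero_ae (hS : IsSubordinator P S) :
    ∀ᵐ ω ∂P, timeChange X S 0 ω = X 0 ω := by
  filter_upwards [hS.zero] with ω hω
  rw [timeChange, hω]

lemma aemeasurable_timeChange (hX : IsMarkovChain P X G) (hS : IsSubordinator P S) (t : ℝ≥0) :
    AEMeasurable (timeChange X S t) P :=
  aemeasurable_comp (T := S t) hX.measurable hX.rightContinuous (hS.measurable t)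

/-- The state probabilities of the time-changed chain are mixtures of transition probabilities. -/
lemma stateProb_timeChange [IsProbabilityMeasure P] (hX : IsMarkovChain P X G)
    (hS : IsSubordinator P S) (hXS : IndepFun (fun ω t => X t ω) (fun ω t => S t ω) P)
    {k : ℤ} (hk : P {ω | timeChange X S 0 ω = k} ≠ 0) :
    ∃ p : ℝ≥0 → ℤ → ℤ → ℝ, IsTransitionFunction p ∧ HasGenerator p G ∧ ∀ t n,
      stateProb P (timeChange X S) k n t = ∫⁻ x, ENNReal.ofReal (p x k n) ∂(P.map (S t)) := by
  obtain ⟨p, hp, hG, hmarkov⟩ := hX.markov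
  refine ⟨p, hp, hG, fun t n => ?_⟩
  -- `S 0 = 0` holds only almost surely, so the conditioning event changes by a null set.
  have hae : ({ω | timeChange X S 0 ω = k} : Set Ω) =ᵐ[P] {ω | X 0 ω = k} := by
    filter_upwards [timeChange_zero_ae (X := X) hS] with ω hω
    exact congrArg (fun y => y = k) hω
  rw [measure_congr hae] at hk
  have hind : IndepFun (fun ω t => X t ω) (S t) P :=
    hXS.comp measurable_id (measurable_pi_apply t)
  have h1 := measure_comp_indep hX.measurable hX.rightContinuous (hS.measurable t) hind
    (k := k) (n := n) (fun x => hp.le_one x k n) (hp.continuous hG k n) (fun x => by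
      simpa using hmarkov 0 (fun _ => 0) (fun _ => k) x n (fun _ _ _ => le_rfl))
  have hkm : MeasurableSet {ω | X 0 ω = k} := hX.measurable 0 (measurableSet_singleton k)
  rw [stateProb, cond_congr_ae hae, cond_apply hkm]
  have h2 : {ω | X 0 ω = k} ∩ {ω | timeChange X S t ω = n} =
      {ω | X 0 ω = k ∧ X (S t ω) ω = n} := rfl
  rw [h2, h1, ← mul_assoc, ENNReal.inv_mul_cancel hk (measure_ne_top _ _), one_mul]

lemma pgf_timeChange [IsProbabilityMeasure P] {α₁ α₂ β₁ β₂ : ℝ}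
    (hα₁ : 0 < α₁) (hα₂ : 0 < α₂) (hβ₁ : 0 < β₁) (hβ₂ : 0 < β₂)
    (hX : IsMarkovChain P X (generator α₁ α₂ β₁ β₂))
    (hS : IsSubordinator P S) (hXS : IndepFun (fun ω t => X t ω) (fun ω t => S t ω) P)
    {k : ℤ} (hk : P {ω | timeChange X S 0 ω = k} ≠ 0) {z : ℝ} (hz : 0 < z) (t : ℝ≥0) :
    pgf P (timeChange X S) k z t =
      ∫⁻ x : ℝ≥0, ENNReal.ofReal (chainPgf α₁ α₂ β₁ β₂ k z x) ∂(P.map (S t)) := by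
  obtain ⟨p, hp, hG, hstate⟩ := stateProb_timeChange hX hS hXS hk
  rw [pgf_eq_tsum (aemeasurable_timeChange hX hS t)]
  have hm : ∀ n, Measurable fun x => ENNReal.ofReal (p x k n) := fun n =>
    (ENNReal.continuous_ofReal.comp (hp.continuous hG k n)).measurable
  simp_rw [hstate, ← lintegral_const_mul _ (hm _)]
  rw [← lintegral_tsum fun n => ((hm n).const_mul _).aemeasurable]
  exact lintegral_congr fun x => tsum_transition_eq hα₁ hα₂ hβ₁ hβ₂ hz hp hG x k

end

/-! ### Laplace transforms of stable laws -/

section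

variable {ν : ℝ} {t : ℝ≥0} {σ : Measure ℝ≥0}

lemma integrable_exp_neg [IsProbabilityMeasure σ] {θ : ℝ} (hθ : 0 ≤ θ) :
    Integrable (fun x : ℝ≥0 => Real.exp (-(θ * (x : ℝ)))) σ := by
  refine Integrable.of_bound (C := 1) ?_ (Eventually.of_forall fun x => ?_)
  · exact (by fun_prop : Continuous fun x : ℝ≥0 => Real.exp (-(θ * (x : ℝ)))).aestronglyMeasurable
  · rw [Real.norm_eq_abs, Real.abs_exp, Real.exp_le_one_iff]
    have := mul_nonneg hθ x.coe_nonneg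
    linarith

/-- A stable law has infinite mean. -/
lemma IsStableLaw.lintegral_eq_top (hσ : IsStableLaw ν t σ) (hν₀ : 0 < ν) (hν₁ : ν < 1)
    (ht : 0 < t) : ∫⁻ x : ℝ≥0, ENNReal.ofReal (x : ℝ) ∂σ = ⊤ := by
  by_contra hfin
  have := hσ.1
  have hint : Integrable (fun x : ℝ≥0 => (x : ℝ)) σ := by
    refine ⟨NNReal.continuous_coe.aestronglyMeasurable, ?_⟩
    rw [hasFiniteIntegral_iff_ofReal (Eventually.of_forall fun x => x.coe_nonneg)]
    exact lt_top_iff_ne_top.mpr hfin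
  set E := ∫ x : ℝ≥0, (x : ℝ) ∂σ with hE
  -- A finite mean `E` would force `1 - exp (-t θ ^ ν) ≤ θ E`. Bounding the left side below by `t θ
  -- ^ ν / (1 + t θ ^ ν)` and dividing by `θ ^ ν` gives this inequality, whose sides tend to `t` and
  -- `0` as `θ → 0+`.
  have hle : ∀ θ : ℝ, 0 < θ → (t : ℝ) / (1 + t * θ ^ ν) ≤ θ ^ (1 - ν) * E := by
    intro θ hθ
    have h1 : 1 - Real.exp (-((t : ℝ) * θ ^ ν)) ≤ θ * E := by
      rw [← hσ.2 θ hθ.le, hE, ← integral_const_mul]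
      have e : (1 : ℝ) = ∫ _ : ℝ≥0, (1 : ℝ) ∂σ := by simp
      rw [e, ← integral_sub (integrable_const _) (integrable_exp_neg hθ.le)]
      refine integral_mono ((integrable_const _).sub (integrable_exp_neg hθ.le))
        (hint.const_mul θ) fun x => ?_
      have := Real.add_one_le_exp (-(θ * (x : ℝ)))
      simp only
      linarith
    have hy : 0 < θ ^ ν := Real.rpow_pos_of_pos hθ ν
    have hty : 0 ≤ (t : ℝ) * θ ^ ν := by positivity
    have h2 : Real.exp (-((t : ℝ) * θ ^ ν)) ≤ 1 / (1 + t * θ ^ ν) := by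
      rw [Real.exp_neg, ← one_div]
      exact one_div_le_one_div_of_le (by positivity)
        (by linarith [Real.add_one_le_exp ((t : ℝ) * θ ^ ν)])
    have h3 : θ ^ ν * ((t : ℝ) / (1 + t * θ ^ ν)) = 1 - 1 / (1 + t * θ ^ ν) := by
      field_simp
      ring
    have h4 : θ ^ ν * (θ ^ (1 - ν) * E) = θ * E := by
      rw [← mul_assoc, ← Real.rpow_add hθ, add_sub_cancel, Real.rpow_one]
    refine le_of_mul_le_mul_left ?_ hy
    rw [h3, h4]
    linarith
  have hlim : ∀ a : ℝ, 0 < a → Tendsto (fun θ : ℝ => θ ^ a) (𝓝[>] 0) (𝓝 0) := by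
    intro a ha
    have h1 := (Real.continuous_rpow_const ha.le).tendsto 0
    rw [Real.zero_rpow ha.ne'] at h1
    exact h1.mono_left nhdsWithin_le_nhds
  have h1 : Tendsto (fun θ : ℝ => (t : ℝ) / (1 + t * θ ^ ν)) (𝓝[>] 0) (𝓝 t) := by
    have h2 : Tendsto (fun θ : ℝ => 1 + (t : ℝ) * θ ^ ν) (𝓝[>] 0) (𝓝 1) := by
      simpa using ((hlim ν hν₀).const_mul (t : ℝ)).const_add 1
    have h3 := (tendsto_const_nhds (x := (t : ℝ))).div h2 one_ne_zero
    rwa [div_one] at h3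
  have h2 : Tendsto (fun θ : ℝ => θ ^ (1 - ν) * E) (𝓝[>] 0) (𝓝 0) := by
    simpa using (hlim (1 - ν) (by linarith)).mul_const E
  have h3 : (t : ℝ) ≤ 0 := le_of_tendsto_of_tendsto h1 h2
    (eventually_nhdsWithin_of_forall fun θ hθ => hle θ hθ)
  exact absurd (NNReal.coe_pos.mpr ht) (not_lt.mpr h3)

end

/-! ### Integration of `chainPgf` against the tempered stable law. -/

/-- The two sides differ by exactly `z ^ k exp (x hMinus)`, so the sign of the weight `1 - c / h` of
the smaller exponential plays no role. Both the nonnegativity of `chainPgf` and the divergence of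
its integral follow from this bound. -/
lemma le_chainPgf (α₁ α₂ β₁ β₂ : ℝ) {z : ℝ} (hz : 0 < z) (k : ℤ) (x : ℝ) :
    z ^ k * ((1 + c α₁ α₂ β₁ β₂ k z / h α₁ α₂ β₁ β₂ z) / 2) *
      (Real.exp (x * hPlus α₁ α₂ β₁ β₂ z) - Real.exp (x * hMinus α₁ α₂ β₁ β₂ z)) ≤
      chainPgf α₁ α₂ β₁ β₂ k z x := by
  have h1 : 0 ≤ z ^ k * Real.exp (x * hMinus α₁ α₂ β₁ β₂ z) := by
    have := zpow_pos hz k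
    positivity
  rw [chainPgf]
  linarith

section

variable {α₁ α₂ β₁ β₂ : ℝ} (hα₁ : 0 < α₁) (hα₂ : 0 < α₂) (hβ₁ : 0 < β₁) (hβ₂ : 0 < β₂)
  {z : ℝ} (hz : 0 < z)
include hα₁ hα₂ hβ₁ hβ₂ hz

lemma hMinus_le_hPlus : hMinus α₁ α₂ β₁ β₂ z ≤ hPlus α₁ α₂ β₁ β₂ z := by
  have h1 : 0 < h α₁ α₂ β₁ β₂ z / z := div_pos (h_pos hα₁ hα₂ hβ₁ hβ₂ hz) hz
  rw [hMinus, hPlus]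
  linarith

lemma chainPgf_weight_pos (k : ℤ) :
    0 < z ^ k * ((1 + c α₁ α₂ β₁ β₂ k z / h α₁ α₂ β₁ β₂ z) / 2) := by
  have h0 := h_pos hα₁ hα₂ hβ₁ hβ₂ hz
  have h1 := h_add_c_pos hα₁ hα₂ hβ₁ hβ₂ hz k
  have h2 : 1 + c α₁ α₂ β₁ β₂ k z / h α₁ α₂ β₁ β₂ z =
      (h α₁ α₂ β₁ β₂ z + c α₁ α₂ β₁ β₂ k z) / h α₁ α₂ β₁ β₂ z := by
    field_simp
  rw [h2]
  have := zpow_pos hz k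
  positivity

lemma chainPgf_nonneg (k : ℤ) {x : ℝ} (hx : 0 ≤ x) : 0 ≤ chainPgf α₁ α₂ β₁ β₂ k z x := by
  refine le_trans (mul_nonneg (chainPgf_weight_pos hα₁ hα₂ hβ₁ hβ₂ hz k).le ?_)
    (le_chainPgf α₁ α₂ β₁ β₂ hz k x)
  exact sub_nonneg.mpr (Real.exp_le_exp.mpr (mul_le_mul_of_nonneg_left
    (hMinus_le_hPlus hα₁ hα₂ hβ₁ hβ₂ hz) hx))

variable {ν μ : ℝ} {t : ℝ≥0} {σ : Measure ℝ≥0} (hσ : IsStableLaw ν t σ)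
include hσ

/-- The condition `hPlus ≤ μ` makes both arguments `μ - hPlus` and `μ - hMinus` of the Laplace
transform nonnegative. The sign of the result is part of the conclusion because `ENNReal.ofReal`
would truncate a negative value. -/
lemma lintegral_chainPgf_eq_ofReal (k : ℤ) (hle : hPlus α₁ α₂ β₁ β₂ z ≤ μ) :
    0 ≤ z ^ k *
      ((Real.exp (-((t : ℝ) * ((μ - hPlus α₁ α₂ β₁ β₂ z) ^ ν - μ ^ ν))) +
          Real.exp (-((t : ℝ) * ((μ - hMinus α₁ α₂ β₁ β₂ z) ^ ν - μ ^ ν)))) / 2 +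
        c α₁ α₂ β₁ β₂ k z / h α₁ α₂ β₁ β₂ z *
        ((Real.exp (-((t : ℝ) * ((μ - hPlus α₁ α₂ β₁ β₂ z) ^ ν - μ ^ ν))) -
          Real.exp (-((t : ℝ) * ((μ - hMinus α₁ α₂ β₁ β₂ z) ^ ν - μ ^ ν)))) / 2)) ∧
    ∫⁻ x : ℝ≥0, ENNReal.ofReal (Real.exp (-(μ * (x : ℝ)) + μ ^ ν * (t : ℝ))) *
      ENNReal.ofReal (chainPgf α₁ α₂ β₁ β₂ k z x) ∂σ =
    ENNReal.ofReal (z ^ k *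
      ((Real.exp (-((t : ℝ) * ((μ - hPlus α₁ α₂ β₁ β₂ z) ^ ν - μ ^ ν))) +
          Real.exp (-((t : ℝ) * ((μ - hMinus α₁ α₂ β₁ β₂ z) ^ ν - μ ^ ν)))) / 2 +
        c α₁ α₂ β₁ β₂ k z / h α₁ α₂ β₁ β₂ z *
        ((Real.exp (-((t : ℝ) * ((μ - hPlus α₁ α₂ β₁ β₂ z) ^ ν - μ ^ ν))) -
          Real.exp (-((t : ℝ) * ((μ - hMinus α₁ α₂ β₁ β₂ z) ^ ν - μ ^ ν)))) / 2))) := by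
  have := hσ.1
  have hmp := hMinus_le_hPlus hα₁ hα₂ hβ₁ hβ₂ hz
  have hnn : ∀ x : ℝ≥0, 0 ≤ chainPgf α₁ α₂ β₁ β₂ k z x := fun x =>
    chainPgf_nonneg hα₁ hα₂ hβ₁ hβ₂ hz k x.coe_nonneg
  simp_rw [← ENNReal.ofReal_mul (Real.exp_nonneg _)]
  have hfun : ∀ x : ℝ≥0, Real.exp (-(μ * (x : ℝ)) + μ ^ ν * (t : ℝ)) *
      chainPgf α₁ α₂ β₁ β₂ k z x =
      Real.exp (μ ^ ν * t) * z ^ k * ((1 + c α₁ α₂ β₁ β₂ k z / h α₁ α₂ β₁ β₂ z) / 2) *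
        Real.exp (-((μ - hPlus α₁ α₂ β₁ β₂ z) * (x : ℝ))) +
      Real.exp (μ ^ ν * t) * z ^ k * ((1 - c α₁ α₂ β₁ β₂ k z / h α₁ α₂ β₁ β₂ z) / 2) *
        Real.exp (-((μ - hMinus α₁ α₂ β₁ β₂ z) * (x : ℝ))) := by
    intro x
    have e : ∀ a : ℝ, Real.exp (-((μ - a) * (x : ℝ))) =
        Real.exp (-(μ * (x : ℝ))) * Real.exp ((x : ℝ) * a) := by
      intro a
      rw [← Real.exp_add]
      congr 1
      ring
    rw [e, e, Real.exp_add, chainPgf]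
    ring
  have hexp : ∀ a : ℝ, Real.exp (-((t : ℝ) * (a ^ ν - μ ^ ν))) =
      Real.exp (μ ^ ν * t) * Real.exp (-((t : ℝ) * a ^ ν)) := by
    intro a
    rw [← Real.exp_add]
    congr 1
    ring
  have hi₁ := (integrable_exp_neg (σ := σ) (θ := μ - hPlus α₁ α₂ β₁ β₂ z) (by linarith)).const_mul
    (Real.exp (μ ^ ν * t) * z ^ k * ((1 + c α₁ α₂ β₁ β₂ k z / h α₁ α₂ β₁ β₂ z) / 2))
  have hi₂ := (integrable_exp_neg (σ := σ) (θ := μ - hMinus α₁ α₂ β₁ β₂ z) (by linarith)).const_mul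
    (Real.exp (μ ^ ν * t) * z ^ k * ((1 - c α₁ α₂ β₁ β₂ k z / h α₁ α₂ β₁ β₂ z) / 2))
  have hval : ∫ x : ℝ≥0, Real.exp (-(μ * (x : ℝ)) + μ ^ ν * (t : ℝ)) *
      chainPgf α₁ α₂ β₁ β₂ k z x ∂σ = z ^ k *
      ((Real.exp (-((t : ℝ) * ((μ - hPlus α₁ α₂ β₁ β₂ z) ^ ν - μ ^ ν))) +
          Real.exp (-((t : ℝ) * ((μ - hMinus α₁ α₂ β₁ β₂ z) ^ ν - μ ^ ν)))) / 2 +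
        c α₁ α₂ β₁ β₂ k z / h α₁ α₂ β₁ β₂ z *
        ((Real.exp (-((t : ℝ) * ((μ - hPlus α₁ α₂ β₁ β₂ z) ^ ν - μ ^ ν))) -
          Real.exp (-((t : ℝ) * ((μ - hMinus α₁ α₂ β₁ β₂ z) ^ ν - μ ^ ν)))) / 2)) := by
    simp_rw [hfun]
    rw [integral_add hi₁ hi₂, integral_const_mul, integral_const_mul,
      hσ.2 _ (by linarith), hσ.2 _ (by linarith), hexp, hexp]
    ring
  have hprod : ∀ x : ℝ≥0, 0 ≤ Real.exp (-(μ * (x : ℝ)) + μ ^ ν * (t : ℝ)) *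
      chainPgf α₁ α₂ β₁ β₂ k z x := fun x => mul_nonneg (Real.exp_nonneg _) (hnn x)
  rw [← hval]
  refine ⟨integral_nonneg hprod, ?_⟩
  refine (ofReal_integral_eq_lintegral_ofReal ?_ (Eventually.of_forall hprod)).symm
  exact (hi₁.add hi₂).congr (Eventually.of_forall fun x => (hfun x).symm)

lemma lintegral_chainPgf_eq_top (k : ℤ) (hν₀ : 0 < ν) (hν₁ : ν < 1) (ht : 0 < t) (hμ : 0 ≤ μ)
    (hlt : μ < hPlus α₁ α₂ β₁ β₂ z) :
    ∫⁻ x : ℝ≥0, ENNReal.ofReal (Real.exp (-(μ * (x : ℝ)) + μ ^ ν * (t : ℝ))) *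
      ENNReal.ofReal (chainPgf α₁ α₂ β₁ β₂ k z x) ∂σ = ⊤ := by
  set W := z ^ k * ((1 + c α₁ α₂ β₁ β₂ k z / h α₁ α₂ β₁ β₂ z) / 2) with hW
  have hWpos : 0 < W := chainPgf_weight_pos hα₁ hα₂ hβ₁ hβ₂ hz k
  have hneg := hMinus_neg hα₁ hα₂ hβ₁ hβ₂ hz
  set K := Real.exp (μ ^ ν * t) * W * (hPlus α₁ α₂ β₁ β₂ z - μ) with hK
  have hKpos : 0 < K := mul_pos (mul_pos (Real.exp_pos _) hWpos) (sub_pos.mpr hlt)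
  have hle : ∀ x : ℝ≥0, ENNReal.ofReal K * ENNReal.ofReal (x : ℝ) ≤
      ENNReal.ofReal (Real.exp (-(μ * (x : ℝ)) + μ ^ ν * (t : ℝ))) *
      ENNReal.ofReal (chainPgf α₁ α₂ β₁ β₂ k z x) := by
    intro x
    have hx := x.coe_nonneg
    rw [← ENNReal.ofReal_mul (Real.exp_nonneg _), ← ENNReal.ofReal_mul hKpos.le]
    refine ENNReal.ofReal_le_ofReal ?_
    -- Linear growth suffices, the mean being infinite: the first exponential is at least `1 +
    -- (hPlus - μ) x`, the second at most `1` since `hMinus < 0 ≤ μ`.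
    have h1 : (hPlus α₁ α₂ β₁ β₂ z - μ) * x ≤
        Real.exp (-(μ * (x : ℝ))) * (Real.exp (x * hPlus α₁ α₂ β₁ β₂ z) -
          Real.exp (x * hMinus α₁ α₂ β₁ β₂ z)) := by
      rw [mul_sub, ← Real.exp_add, ← Real.exp_add]
      have h2 := Real.add_one_le_exp (-(μ * (x : ℝ)) + x * hPlus α₁ α₂ β₁ β₂ z)
      have h3 : Real.exp (-(μ * (x : ℝ)) + x * hMinus α₁ α₂ β₁ β₂ z) ≤ 1 := by
        rw [Real.exp_le_one_iff]
        nlinarith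
      linarith
    calc K * x = Real.exp (μ ^ ν * t) * W * ((hPlus α₁ α₂ β₁ β₂ z - μ) * x) := by
          rw [hK]; ring
      _ ≤ Real.exp (μ ^ ν * t) * W * (Real.exp (-(μ * (x : ℝ))) *
          (Real.exp (x * hPlus α₁ α₂ β₁ β₂ z) - Real.exp (x * hMinus α₁ α₂ β₁ β₂ z))) := by
        gcongr
      _ = Real.exp (-(μ * (x : ℝ)) + μ ^ ν * (t : ℝ)) * (W *
          (Real.exp (x * hPlus α₁ α₂ β₁ β₂ z) - Real.exp (x * hMinus α₁ α₂ β₁ β₂ z))) := by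
        rw [Real.exp_add]; ring
      _ ≤ _ := by
        gcongr
        exact le_chainPgf α₁ α₂ β₁ β₂ hz k x
  refine eq_top_mono (lintegral_mono hle) ?_
  rw [lintegral_const_mul _ (by fun_prop), hσ.lintegral_eq_top hν₀ hν₁ ht,
    ENNReal.mul_top (ENNReal.ofReal_pos.mpr hKpos).ne']

end

end AlternatingChain

theorem proposition5p1
    {Ω : Type*} [MeasurableSpace Ω] (P : Measure Ω) [IsProbabilityMeasure P]
    (α₁ α₂ β₁ β₂ : ℝ) (hα₁ : 0 < α₁) (hα₂ : 0 < α₂) (hβ₁ : 0 < β₁) (hβ₂ : 0 < β₂)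
    (ν μ : ℝ) (hν₀ : 0 < ν) (hν₁ : ν < 1) (hμ : 0 ≤ μ)
    (X : ℝ≥0 → Ω → ℤ) (S : ℝ≥0 → Ω → ℝ≥0)
    (hX : AlternatingChain.IsMarkovChain P X (AlternatingChain.generator α₁ α₂ β₁ β₂))
    (hS : AlternatingChain.IsTemperedStableSubordinator P ν μ S)
    (hXS : IndepFun (fun ω t => X t ω) (fun ω t => S t ω) P)
    (k : ℤ) (hk : P {ω | AlternatingChain.timeChange X S 0 ω = k} ≠ 0)
    (z : ℝ) (hz : 0 < z) (t : ℝ≥0) :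
    AlternatingChain.pgf P (AlternatingChain.timeChange X S) k z t =
      ∑' n : ℤ, ENNReal.ofReal (z ^ n) *
        AlternatingChain.stateProb P (AlternatingChain.timeChange X S) k n t ∧
    (AlternatingChain.hPlus α₁ α₂ β₁ β₂ z ≤ μ →
      ((AlternatingChain.pgf P (AlternatingChain.timeChange X S) k z t : ℝ≥0∞) : EReal) =
        ((z ^ k *
          ((Real.exp (-((t : ℝ) * ((μ - AlternatingChain.hPlus α₁ α₂ β₁ β₂ z) ^ ν - μ ^ ν))) +
              Real.exp (-((t : ℝ) * ((μ - AlternatingChain.hMinus α₁ α₂ β₁ β₂ z) ^ ν - μ ^ ν))))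
              / 2 +
            AlternatingChain.c α₁ α₂ β₁ β₂ k z / AlternatingChain.h α₁ α₂ β₁ β₂ z *
            ((Real.exp (-((t : ℝ) * ((μ - AlternatingChain.hPlus α₁ α₂ β₁ β₂ z) ^ ν - μ ^ ν))) -
              Real.exp (-((t : ℝ) * ((μ - AlternatingChain.hMinus α₁ α₂ β₁ β₂ z) ^ ν - μ ^ ν))))
              / 2)) : ℝ) : EReal)) ∧
    (μ < AlternatingChain.hPlus α₁ α₂ β₁ β₂ z → 0 < t →
      AlternatingChain.pgf P (AlternatingChain.timeChange X S) k z t = ⊤) := by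
  have hsub := hS.toIsSubordinator
  have hpgf := AlternatingChain.pgf_timeChange hα₁ hα₂ hβ₁ hβ₂ hX hsub hXS hk hz t
  obtain ⟨σ, hσ, hlaw⟩ := hS.law t
  have hmeas : Measurable fun x : ℝ≥0 =>
      ENNReal.ofReal (AlternatingChain.chainPgf α₁ α₂ β₁ β₂ k z x) := by
    unfold AlternatingChain.chainPgf
    fun_prop
  rw [hlaw, lintegral_withDensity_eq_lintegral_mul _ (by fun_prop) hmeas] at hpgf
  refine ⟨AlternatingChain.pgf_eq_tsum (AlternatingChain.aemeasurable_timeChange hX hsub t) k z,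
    fun hle => ?_, fun hlt ht => ?_⟩
  · obtain ⟨hnn, hval⟩ :=
      AlternatingChain.lintegral_chainPgf_eq_ofReal hα₁ hα₂ hβ₁ hβ₂ hz hσ k hle
    -- The embedding of `ENNReal.ofReal a` in `EReal` is `max a 0`, which nonnegativity identifies
    -- with `a`.
    rw [hpgf, ← max_eq_left hnn, ← EReal.coe_ennreal_ofReal]
    exact congrArg _ hval
  · rw [hpgf]
    exact AlternatingChain.lintegral_chainPgf_eq_top hα₁ hα₂ hβ₁ hβ₂ hz hσ k hν₀ hν₁ ht hμ hlt
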